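/- **Theorem (Coercivity).** Let $d\ge 1$ and $p\ge 1$ be integers. For each $j\in\{1,\dots,d\}$ let $0=x^j_0<x^j_1<\dots<x^j_{N_j}=1$ be a partition of $[0,1]$, and let $\mathcal T_h$ be the resulting tensor-product mesh of $\Omega=[0,1]^d$, whose elements are the closed boxes $E=\prod_{j}[x^j_{i_j-1},x^j_{i_j}]$. Let $h$ denote the smallest edge length of the elements, $h=\min_{j,i}(x^j_i-x^j_{i-1})$ (so $h$ is the usual mesh width, $h=1/N$, on a uniform mesh with $N$ elements per direction). *Space.* Let $\tilde V^j$ be the space of all $u\in C^{p-1}([0,1])$ that are polynomials of degree at most $p$ on each $[x^j_{i-1},x^j_i]$ and satisfy $u^{(2\alpha)}(0)=u^{(2\alpha)}(1)=0$ for $\alpha=0,1,\dots,\lfloor (p-1)/2\rfloor$. The outlier-free spline space $\tilde V^h_p$ is the tensor product of $\tilde V^1,\dots,\tilde V^d$, i.e. the linear span of the functions $x\mapsto\prod_j u_j(x_j)$ with $u_j\in\tilde V^j$. *Forms.* Let $\hat\nabla^p v=(\partial^p_{x_1}v,\dots,\partial^p_{x_d}v)^T$. On an interior face $F=E_1\cap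 E_2$ put $[\![\hat\nabla^p v\cdot n]\!]=\hat\nabla^p v|_{E_1}\cdot n_1+\hat\nabla^p v|_{E_2}\cdot n_2$, with $n_1,n_2$ the outward unit normals of $E_1,E_2$, and on a boundary face $F_b$ of an element $E$ put $[\![\hat\nabla^p v\cdot n]\!]=\hat\nabla^p v|_E\cdot n_{F_b}$. With $\mathcal F$ and $\mathcal F_b$ the sets of interior and of boundary faces, and $(\cdot,\cdot)_F$ the $L^2$ inner product on the face $F$, let $$a(w,v)=\int_\Omega\nabla w\cdot\nabla v\,dx,\qquad s(w,v)=\sum_{F\in\mathcal F}h^{2p-1}\big([\![\hat\nabla^p w\cdot n]\!],[\![\hat\nabla^p v\cdot n]\!]\big)_F+\theta_p\sum_{F\in\mathcal F_b}h^{2p-1}\big([\![\hat\nabla^p w\cdot n]\!],[\![\hat\nabla^p v\cdot n]\!]\big)_F,$$ where $\theta_p=0$ if $p$ is odd and $\theta_p=2$ if $p$ is even. *Claim.* Let $$C_{p,3}=\sqrt{\frac{(p-1)!\,p!\,(p+1)!\,(p+2)!}{3\cdot 2^p}},\qquad \eta_{\max}=\frac1{2C_{p,3}^2}.$$ Then for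 every $\eta\in[0,\eta_{\max})$ the number $\beta=1-\eta/\eta_{\max}$ is positive and $$a(w,w)-\eta\,s(w,w)\ \ge\ \beta\,|w|^2_{H^1(\Omega)}\qquad\text{for all } w\in\tilde V^h_p,$$ where $|w|_{H^1(\Omega)}=\|\nabla w\|_{L^2(\Omega)}$. -/

import Mathlib

open MeasureTheory
open scoped Nat

noncomputable section

namespace SoftIGA

/-- A tensor-product mesh of the cube `[0,1]^d`: in each coordinate direction `j` a partition
`0 = x_0 < x_1 < ... < x_{N j} = 1` of the unit interval into `N j` intervals. -/
structure TensorMesh (d : ℕ) where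
  /-- number of intervals in each direction -/
  N : Fin d → ℕ
  /-- mesh nodes in each direction -/
  knot : (j : Fin d) → Fin (N j + 1) → ℝ
  strictMono : ∀ j, StrictMono (knot j)
  knot_first : ∀ j, knot j 0 = 0
  knot_last : ∀ j, knot j (Fin.last (N j)) = 1

/-- The elements of the mesh, indexed by their positions in the coordinate directions. -/
abbrev TensorMesh.Elem {d : ℕ} (T : TensorMesh d) : Type := (j : Fin d) → Fin (T.N j)

/-- Left end point of the `i`-th interval in direction `j`. -/
def TensorMesh.left {d : ℕ} (T : TensorMesh d) (j : Fin d) (i : Fin (T.N j)) : ℝ :=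
  T.knot j i.castSucc

/-- Right end point of the `i`-th interval in direction `j`. -/
def TensorMesh.right {d : ℕ} (T : TensorMesh d) (j : Fin d) (i : Fin (T.N j)) : ℝ :=
  T.knot j i.succ

/-- The `i`-th (closed) interval in direction `j`. -/
def TensorMesh.cell {d : ℕ} (T : TensorMesh d) (j : Fin d) (i : Fin (T.N j)) : Set ℝ :=
  Set.Icc (T.left j i) (T.right j i)

/-- The mesh size `h`: the smallest edge length of the elements of the mesh. -/
def TensorMesh.meshSize {d : ℕ} (T : TensorMesh d) : ℝ :=
  ⨅ c : (j : Fin d) × Fin (T.N j), (T.right c.1 c.2 - T.left c.1 c.2)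

/-- The outlier-free space in direction `j`: functions that are `C^{p-1}` on `[0,1]`, are
polynomials of degree at most `p` on each mesh interval, and whose derivatives of order `2 α`,
`0 ≤ α ≤ ⌊(p-1)/2⌋`, vanish at both end points.  (Functions are total on `ℝ`; their values
outside `[0,1]` play no role.) -/
def TensorMesh.space1D {d : ℕ} (T : TensorMesh d) (p : ℕ) (j : Fin d) : Set (ℝ → ℝ) :=
  {u | ContDiffOn ℝ ((p - 1 : ℕ) : WithTop ℕ∞) u (Set.Icc 0 1) ∧
    (∀ i : Fin (T.N j), ∃ q : Polynomial ℝ, q.natDegree ≤ p ∧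
      ∀ t ∈ T.cell j i, u t = q.eval t) ∧
    ∀ α : ℕ, α ≤ (p - 1) / 2 →
      iteratedDerivWithin (2 * α) u (Set.Icc 0 1) 0 = 0 ∧
      iteratedDerivWithin (2 * α) u (Set.Icc 0 1) 1 = 0}

/-- The outlier-free space on the mesh: the tensor product of the one-dimensional ones. -/
def TensorMesh.space {d : ℕ} (T : TensorMesh d) (p : ℕ) : Submodule ℝ ((Fin d → ℝ) → ℝ) :=
  Submodule.span ℝ {w | ∃ u : Fin d → ℝ → ℝ, (∀ j, u j ∈ T.space1D p j) ∧
    w = fun x => ∏ j, u j (x j)}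

/-- The partial derivative `∂w/∂x_j` at `x`. -/
def partialDeriv {d : ℕ} (w : (Fin d → ℝ) → ℝ) (j : Fin d) (x : Fin d → ℝ) : ℝ :=
  deriv (fun t => w (Function.update x j t)) (x j)

/-- `a(w,v) = ∫_{[0,1]^d} ∇w · ∇v`.  (A continuous, piecewise polynomial function is
differentiable off the mesh skeleton, which is a null set.) -/
def stiffnessForm {d : ℕ} (w v : (Fin d → ℝ) → ℝ) : ℝ :=
  ∫ x in Set.Icc (0 : Fin d → ℝ) 1, ∑ j, partialDeriv w j x * partialDeriv v j x

/-- The `H¹`-seminorm on `[0,1]^d`. -/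
def h1Seminorm {d : ℕ} (w : (Fin d → ℝ) → ℝ) : ℝ :=
  √(∫ x in Set.Icc (0 : Fin d → ℝ) 1, ∑ j, (partialDeriv w j x) ^ 2)

/-- `∂^p/∂x_j^p` of the restriction of `w` to the closed element `E`, at a point `x` of `E`
(one-sided if `x` lies on a face of `E` normal to direction `j`). -/
def TensorMesh.elemDeriv {d : ℕ} (T : TensorMesh d) (p : ℕ) (w : (Fin d → ℝ) → ℝ)
    (E : T.Elem) (j : Fin d) (x : Fin d → ℝ) : ℝ :=
  iteratedDerivWithin p (fun t => w (Function.update x j t)) (T.cell j (E j)) (x j)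

/-- The point with `j`-th coordinate `c` and other coordinates `y`. -/
def facePoint {d : ℕ} (j : Fin d) (c : ℝ) (y : {k : Fin d // k ≠ j} → ℝ) : Fin d → ℝ :=
  fun k => if hk : k = j then c else y ⟨k, hk⟩

/-- Integral, with respect to the `(d-1)`-dimensional surface measure, over the face of the
element `E` that lies in the hyperplane `x_j = c` (where `c` is an end point of the edge of `E`
in direction `j`). -/
def TensorMesh.faceIntegral {d : ℕ} (T : TensorMesh d) (E : T.Elem) (j : Fin d) (c : ℝ)
    (f : (Fin d → ℝ) → ℝ) : ℝ :=
  ∫ y in {y : {k : Fin d // k ≠ j} → ℝ | ∀ k, y k ∈ T.cell k.1 (E k.1)}, f (facePoint j c y)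

open Classical in
/-- The interior faces `F`, encoded by the normal direction `j` and the two elements sharing `F`:
`E₂` is the neighbour of `E₁` on the side of larger `x_j`. -/
def TensorMesh.interiorFaces {d : ℕ} (T : TensorMesh d) : Finset (Fin d × T.Elem × T.Elem) :=
  Finset.univ.filter fun F =>
    (F.2.2 F.1 : ℕ) = (F.2.1 F.1 : ℕ) + 1 ∧ ∀ k, k ≠ F.1 → F.2.2 k = F.2.1 k

open Classical in
/-- The boundary faces in the hyperplanes `x_j = 0`, encoded by `j` and the adjacent element. -/
def TensorMesh.lowerBoundaryFaces {d : ℕ} (T : TensorMesh d) : Finset (Fin d × T.Elem) :=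
  Finset.univ.filter fun F => (F.2 F.1 : ℕ) = 0

open Classical in
/-- The boundary faces in the hyperplanes `x_j = 1`, encoded by `j` and the adjacent element. -/
def TensorMesh.upperBoundaryFaces {d : ℕ} (T : TensorMesh d) : Finset (Fin d × T.Elem) :=
  Finset.univ.filter fun F => (F.2 F.1 : ℕ) + 1 = T.N F.1

/-- The jump `(∂^p w/∂x_1^p, ..., ∂^p w/∂x_d^p)|_{E₁} · n₁ + (...)|_{E₂} · n₂` on an interior face.
The outward unit normal of `E₁` there is `e_j`, that of `E₂` is `-e_j`. -/
def TensorMesh.jump {d : ℕ} (T : TensorMesh d) (p : ℕ) (w : (Fin d → ℝ) → ℝ)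
    (F : Fin d × T.Elem × T.Elem) (x : Fin d → ℝ) : ℝ :=
  T.elemDeriv p w F.2.1 F.1 x * 1 + T.elemDeriv p w F.2.2 F.1 x * (-1)

/-- The interior face part `∑_F h^{2p-1} (⟦∇̂^p w · n⟧, ⟦∇̂^p v · n⟧)_F`. -/
def TensorMesh.interiorPenalty {d : ℕ} (T : TensorMesh d) (p : ℕ)
    (w v : (Fin d → ℝ) → ℝ) : ℝ :=
  ∑ F ∈ T.interiorFaces, T.meshSize ^ (2 * p - 1) *
    T.faceIntegral F.2.1 F.1 (T.right F.1 (F.2.1 F.1)) (fun x => T.jump p w F x * T.jump p v F x)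

/-- The boundary face part `∑_{F_b} h^{2p-1} (∇̂^p w · n, ∇̂^p v · n)_{F_b}`; the outward unit
normal is `-e_j` on the lower and `e_j` on the upper boundary faces. -/
def TensorMesh.boundaryPenalty {d : ℕ} (T : TensorMesh d) (p : ℕ)
    (w v : (Fin d → ℝ) → ℝ) : ℝ :=
  ∑ F ∈ T.lowerBoundaryFaces, T.meshSize ^ (2 * p - 1) *
      T.faceIntegral F.2 F.1 (T.left F.1 (F.2 F.1))
        (fun x => (T.elemDeriv p w F.2 F.1 x * (-1)) * (T.elemDeriv p v F.2 F.1 x * (-1))) +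
  ∑ F ∈ T.upperBoundaryFaces, T.meshSize ^ (2 * p - 1) *
      T.faceIntegral F.2 F.1 (T.right F.1 (F.2 F.1))
        (fun x => (T.elemDeriv p w F.2 F.1 x * 1) * (T.elemDeriv p v F.2 F.1 x * 1))

open Classical in
/-- The softness bilinear form `s(w,v)`. -/
def TensorMesh.softnessForm {d : ℕ} (T : TensorMesh d) (p : ℕ)
    (w v : (Fin d → ℝ) → ℝ) : ℝ :=
  if Odd p then T.interiorPenalty p w v
  else T.interiorPenalty p w v + 2 * T.boundaryPenalty p w v

/-- The softIGA bilinear form `a(w,v) - η s(w,v)`. -/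
def TensorMesh.softForm {d : ℕ} (T : TensorMesh d) (p : ℕ) (η : ℝ)
    (w v : (Fin d → ℝ) → ℝ) : ℝ :=
  stiffnessForm w v - η * T.softnessForm p w v

/-- The constant `C_{p,3}`. -/
def Cp3 (p : ℕ) : ℝ :=
  √((((p - 1)! * p ! * (p + 1)! * (p + 2)! : ℕ) : ℝ) / (3 * 2 ^ p))

/-- The maximal softness parameter `η_max`. -/
def etaMax (p : ℕ) : ℝ := 1 / (2 * Cp3 p ^ 2)

end SoftIGA

end

/-! The claim reduces to `s(w,w) ≤ 2 C_{p,3}² a(w,w)`, since `1/η_max = 2 C_{p,3}²`. This bound is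
local. On an element, `w` restricted to a line in direction `j` is a polynomial `q` of degree at
most `p`, so its `p`-th derivative is a constant, the same at both ends of the edge. Comparing `q'`
with the Legendre polynomial of degree `p - 1` gives the sharp inverse inequality `ℓ^(2p-1) |q⁽ᵖ⁾|²
≤ inverseConst p * ‖q'‖²` on an edge of length `ℓ ≥ h` (`sq_factorial_mul_coeff_le`). Integrating
over the face yields `meshSize_pow_mul_integral_le`. A squared jump is at most twice the sum of the
two squares, and the boundary weight is at most 2. Each element has two faces per direction, so its
contribution is counted at most 4 times (`softnessForm_le_sum`). What remains is the numerical
inequality `4 * inverseConst p ≤ 2 C_{p,3}²` (`inverseConst_le`). -/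

noncomputable section

namespace SoftIGA

/-! ### Legendre polynomials and the leading coefficient -/

section Legendre

open Polynomial

lemma iterate_derivative_eq_C {q : ℝ[X]} {n : ℕ} (hq : q.natDegree ≤ n) :
    derivative^[n] q = C ((n ! : ℝ) * q.coeff n) := by
  ext m
  rw [coeff_iterate_derivative, coeff_C]
  split_ifs with hm
  · subst hm
    simp [Nat.descFactorial_self, nsmul_eq_mul]
  · rw [coeff_eq_zero_of_natDegree_lt (by omega)]
    simp

lemma integral_mul_derivative_of_eval_eq_zero (v P : ℝ[X]) {a b : ℝ} (ha : P.eval a = 0)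
    (hb : P.eval b = 0) :
    ∫ x in a..b, v.eval x * (derivative P).eval x =
      -∫ x in a..b, (derivative v).eval x * P.eval x := by
  rw [intervalIntegral.integral_mul_deriv_eq_deriv_mul (fun x _ => v.hasDerivAt x)
    (fun x _ => P.hasDerivAt x) ((derivative v).continuous.intervalIntegrable _ _)
    ((derivative P).continuous.intervalIntegrable _ _), ha, hb]
  ring

lemma integral_mul_iterate_derivative (n : ℕ) (v P : ℝ[X]) {a b : ℝ}
    (ha : ∀ k < n, (derivative^[k] P).eval a = 0) (hb : ∀ k < n, (derivative^[k] P).eval b = 0) :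
    ∫ x in a..b, v.eval x * (derivative^[n] P).eval x =
      (-1) ^ n * ∫ x in a..b, (derivative^[n] v).eval x * P.eval x := by
  induction n generalizing v with
  | zero => simp
  | succ n ih =>
    rw [Function.iterate_succ_apply' derivative n P,
      integral_mul_derivative_of_eval_eq_zero _ _ (ha n n.lt_succ_self) (hb n n.lt_succ_self),
      ih _ (fun k hk => ha k (by omega)) (fun k hk => hb k (by omega)),
      Function.iterate_succ_apply]
    ring

/-- The Beta integral: each integration by parts trades a factor `b - x` for a factor `x - a`. It
normalises the Rodrigues polynomial below. -/
lemma integral_sub_pow_mul_sub_pow (a b : ℝ) (m n : ℕ) :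
    ∫ x in a..b, (x - a) ^ m * (b - x) ^ n =
      (m ! : ℝ) * n ! / (m + n + 1)! * (b - a) ^ (m + n + 1) := by
  induction n generalizing m with
  | zero =>
    have h := intervalIntegral.integral_comp_sub_right (a := a) (b := b) (fun x : ℝ => x ^ m) a
    simp only [pow_zero, mul_one, add_zero]
    rw [h, integral_pow, Nat.factorial_succ]
    have := Nat.factorial_ne_zero m
    push_cast
    field_simp
    simp
  | succ n ih =>
    have e1 : ∀ x : ℝ, HasDerivAt (fun x : ℝ => (b - x) ^ (n + 1)) (-((n + 1) * (b - x) ^ n)) x := by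
      intro x
      have := ((hasDerivAt_id x).const_sub b).pow (n + 1)
      refine this.congr_deriv ?_
      simp
    have e2 : ∀ x : ℝ, HasDerivAt (fun x : ℝ => (x - a) ^ (m + 1)) ((m + 1) * (x - a) ^ m) x := by
      intro x
      have := ((hasDerivAt_id x).sub_const a).pow (m + 1)
      refine this.congr_deriv ?_
      simp
    have key := intervalIntegral.integral_mul_deriv_eq_deriv_mul (a := a) (b := b)
      (fun x _ => e1 x) (fun x _ => e2 x)
      (Continuous.intervalIntegrable (by fun_prop) _ _)
      (Continuous.intervalIntegrable (by fun_prop) _ _)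
    have k1 : ∫ x in a..b, (b - x) ^ (n + 1) * ((m + 1) * (x - a) ^ m) =
        (m + 1) * ∫ x in a..b, (x - a) ^ m * (b - x) ^ (n + 1) := by
      rw [← intervalIntegral.integral_const_mul]
      congr 1; ext x; ring
    have k2 : ∫ x in a..b, -((n + 1) * (b - x) ^ n) * (x - a) ^ (m + 1) =
        -((n + 1) * ∫ x in a..b, (x - a) ^ (m + 1) * (b - x) ^ n) := by
      rw [← intervalIntegral.integral_const_mul, ← intervalIntegral.integral_neg]
      congr 1; ext x; ring
    rw [k1, k2, ih] at key
    simp only [sub_self, ne_eq, Nat.succ_ne_zero, not_false_eq_true, zero_pow, zero_mul, mul_zero,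
      sub_neg_eq_add, zero_add] at key
    have hm : ((m : ℝ) + 1) ≠ 0 := by positivity
    apply mul_left_cancel₀ hm
    rw [key, show m + 1 + n + 1 = m + (n + 1) + 1 by ring, Nat.factorial_succ m,
      Nat.factorial_succ n]
    push_cast
    ring

/-- Sharp lower bound of the `L²` norm of a polynomial by its leading coefficient; equality holds
for the Legendre polynomials. -/
lemma sq_factorial_mul_coeff_le (n : ℕ) {v : ℝ[X]} (hv : v.natDegree ≤ n) {a b : ℝ} (hab : a ≤ b) :
    ((n ! : ℝ) * v.coeff n) ^ 2 * (b - a) ^ (2 * n + 1) ≤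
      ((2 * n)! : ℝ) * (2 * n + 1)! / (n ! : ℝ) ^ 2 * ∫ x in a..b, (v.eval x) ^ 2 := by
  -- Rodrigues' formula: `P` vanishes to order `n` at both end points, so its `n`-th derivative `L`
  -- is, up to scaling, the Legendre polynomial on `[a,b]`, and integration by parts against `L`
  -- leaves no boundary terms.
  set P : ℝ[X] := (X - C a) ^ n * (C b - X) ^ n with hP
  have hdeg1 : ((X - C a) ^ n : ℝ[X]).natDegree ≤ n := by
    refine natDegree_pow_le.trans ?_
    simp
  have hb1 : (C b - X : ℝ[X]) = -(X - C b) := by ring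
  have hdeg2 : ((C b - X) ^ n : ℝ[X]).natDegree ≤ n := by
    refine natDegree_pow_le.trans ?_
    rw [hb1, natDegree_neg]
    simp
  have hdeg : P.natDegree ≤ n + n := natDegree_mul_le.trans (add_le_add hdeg1 hdeg2)
  have hmon : ∀ c : ℝ, ((X - C c) ^ n : ℝ[X]).coeff n = 1 := fun c => by
    have h := ((monic_X_sub_C c).pow n).coeff_natDegree
    rwa [(monic_X_sub_C c).natDegree_pow, natDegree_X_sub_C, mul_one] at h
  have hcoeff : P.coeff (n + n) = (-1) ^ n := by
    rw [hP, coeff_mul_add_eq_of_natDegree_le hdeg1 hdeg2, hmon, hb1, neg_pow,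
      show ((-1 : ℝ[X]) ^ n) = C ((-1) ^ n) by simp, coeff_C_mul, hmon]
    ring
  have hroot : ∀ c : ℝ, (X - C c) ^ n ∣ P → ∀ k < n, (derivative^[k] P).eval c = 0 := by
    intro c hc k hk
    have h := pow_sub_dvd_iterate_derivative_of_pow_dvd k hc
    have h2 : (X - C c) ∣ derivative^[k] P := (dvd_pow_self _ (by omega)).trans h
    exact dvd_iff_isRoot.1 h2
  have ha : ∀ k < n, (derivative^[k] P).eval a = 0 := hroot a (Dvd.intro _ rfl)
  have hb : ∀ k < n, (derivative^[k] P).eval b = 0 := hroot b (by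
    rw [hP, hb1, neg_pow]
    exact Dvd.intro_left ((X - C a) ^ n * (-1) ^ n) (by ring))
  set I : ℝ := (n ! : ℝ) * n ! / (2 * n + 1)! * (b - a) ^ (2 * n + 1) with hI
  have hint : ∫ x in a..b, P.eval x = I := by
    have h := integral_sub_pow_mul_sub_pow a b n n
    rw [← two_mul] at h
    rw [hI, ← h]
    congr 1; ext x; simp [hP]
  set L : ℝ[X] := derivative^[n] P with hL
  set D : ℝ := (n ! : ℝ) * v.coeff n with hD
  have hvL : ∫ x in a..b, v.eval x * L.eval x = (-1) ^ n * (D * I) := by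
    rw [hL, integral_mul_iterate_derivative n v P ha hb, iterate_derivative_eq_C hv]
    simp only [eval_C]
    rw [intervalIntegral.integral_const_mul, hint]
  have hLL : ∫ x in a..b, L.eval x * L.eval x = (2 * n)! * I := by
    have h := integral_mul_iterate_derivative n L P ha hb
    rw [← hL] at h
    rw [h, hL, ← Function.iterate_add_apply, iterate_derivative_eq_C hdeg, hcoeff]
    simp only [eval_C]
    rw [intervalIntegral.integral_const_mul, hint, two_mul]
    have : ((-1 : ℝ) ^ n) * (-1) ^ n = 1 := by rw [← mul_pow]; simp
    linear_combination (((n + n)! : ℝ) * I) * this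
  -- The coefficient `⟨v,L⟩ / ⟨L,L⟩` of the projection of `v` onto `L`, with the common factor `I`
  -- cancelled so that `a = b` needs no separate case. The bound is then `‖v - l L‖² ≥ 0`.
  set l : ℝ := (-1) ^ n * D / (2 * n)! with hl
  have hpos : 0 ≤ ∫ x in a..b, (v.eval x - l * L.eval x) ^ 2 :=
    intervalIntegral.integral_nonneg hab fun x _ => sq_nonneg _
  have hexp : ∫ x in a..b, (v.eval x - l * L.eval x) ^ 2 =
      (∫ x in a..b, (v.eval x) ^ 2) - 2 * l * ((-1) ^ n * (D * I)) + l ^ 2 * ((2 * n)! * I) := by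
    rw [← hvL, ← hLL, ← intervalIntegral.integral_const_mul, ← intervalIntegral.integral_const_mul,
      ← intervalIntegral.integral_sub, ← intervalIntegral.integral_add]
    · congr 1; ext x; ring
    all_goals exact Continuous.intervalIntegrable (by fun_prop) _ _
  have hs : ((-1 : ℝ) ^ n) * (-1) ^ n = 1 := by rw [← mul_pow]; simp
  have hF : (0 : ℝ) < (2 * n)! := by positivity
  have hG : (0 : ℝ) < (2 * n + 1)! := by positivity
  have hH : (0 : ℝ) < n ! := by positivity
  have hfin : (∫ x in a..b, (v.eval x) ^ 2) - 2 * l * ((-1) ^ n * (D * I)) + l ^ 2 * ((2 * n)! * I) =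
      (∫ x in a..b, (v.eval x) ^ 2) - D ^ 2 * I / (2 * n)! := by
    rw [hl]
    field_simp
    linear_combination (-D ^ 2 * I) * hs
  rw [hexp, hfin] at hpos
  have h1 : D ^ 2 * (b - a) ^ (2 * n + 1) =
      ((2 * n)! : ℝ) * (2 * n + 1)! / (n ! : ℝ) ^ 2 * (D ^ 2 * I / (2 * n)!) := by
    rw [hI]
    field_simp
  rw [h1]
  gcongr
  linarith

end Legendre

/-! ### The inverse inequality and its constant -/

/-- The square of the constant `C` in the inverse inequality `ℓ^(p - 1/2) |v⁽ᵖ⁾| ≤ C ‖v'‖` for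
polynomials `v` of degree `p` on an interval of length `ℓ`. -/
def inverseConst (p : ℕ) : ℝ := ((2 * (p - 1))! : ℝ) * (2 * (p - 1) + 1)! / ((p - 1)! : ℝ) ^ 2

lemma inverseConst_nonneg (p : ℕ) : 0 ≤ inverseConst p := by
  unfold inverseConst; positivity

lemma Cp3_sq (p : ℕ) : Cp3 p ^ 2 =
    (((p - 1)! * p ! * (p + 1)! * (p + 2)! : ℕ) : ℝ) / (3 * 2 ^ p) :=
  Real.sq_sqrt (by positivity)

lemma Cp3_sq_pos (p : ℕ) : 0 < Cp3 p ^ 2 := by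
  rw [Cp3_sq]; positivity

lemma inverseConst_succ {p : ℕ} (hp : 1 ≤ p) :
    inverseConst (p + 1) = 4 * (2 * p - 1) * (2 * p + 1) * inverseConst p := by
  obtain ⟨n, rfl⟩ : ∃ n, p = n + 1 := ⟨p - 1, by omega⟩
  simp only [inverseConst, Nat.add_sub_cancel]
  rw [show 2 * (n + 1) + 1 = 2 * n + 1 + 1 + 1 by ring, show 2 * (n + 1) = 2 * n + 1 + 1 by ring]
  simp only [Nat.factorial_succ]
  push_cast
  have : (n ! : ℝ) ≠ 0 := by positivity
  field_simp
  ring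

lemma Cp3_sq_succ {p : ℕ} (hp : 1 ≤ p) :
    Cp3 (p + 1) ^ 2 = (p * (p + 1) * (p + 2) * (p + 3) / 2) * Cp3 p ^ 2 := by
  obtain ⟨n, rfl⟩ : ∃ n, p = n + 1 := ⟨p - 1, by omega⟩
  simp only [Cp3_sq, Nat.add_sub_cancel, Nat.factorial_succ]
  push_cast
  field_simp
  ring

/-- Equality holds for `p = 1, 2, 3`; from there on the right side grows by the larger factor at
each step. The 4 is the face count, and the right side is `1 / etaMax p`. -/
lemma inverseConst_le {p : ℕ} (hp : 1 ≤ p) : 4 * inverseConst p ≤ 2 * Cp3 p ^ 2 := by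
  have h1 : 4 * inverseConst 1 = 2 * Cp3 1 ^ 2 := by
    norm_num [Cp3_sq, inverseConst, Nat.factorial]
  have h2 : 4 * inverseConst 2 = 2 * Cp3 2 ^ 2 := by
    norm_num [Cp3_sq, inverseConst, Nat.factorial]
  have h3 : 4 * inverseConst 3 = 2 * Cp3 3 ^ 2 := by
    norm_num [Cp3_sq, inverseConst, Nat.factorial]
  rcases (by omega : p = 1 ∨ p = 2 ∨ 3 ≤ p) with rfl | rfl | h
  · exact h1.le
  · exact h2.le
  clear hp
  induction p, h using Nat.le_induction with
  | base => exact h3.le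
  | succ p hp ih =>
    rw [inverseConst_succ (by omega), Cp3_sq_succ (by omega)]
    have hp' : (3 : ℝ) ≤ p := by exact_mod_cast hp
    have hr : (4 * (2 * p - 1) * (2 * p + 1) : ℝ) ≤ p * (p + 1) * (p + 2) * (p + 3) / 2 := by
      -- Expanded around 3, the difference of the two growth factors has only nonnegative
      -- coefficients.
      obtain ⟨x, hx⟩ : ∃ x : ℝ, (p : ℝ) = 3 + x := ⟨p - 3, by ring⟩
      have hx0 : 0 ≤ x := by linarith
      rw [hx, ← sub_nonneg]
      ring_nf
      positivity
    have h0 : (0 : ℝ) ≤ 4 * (2 * p - 1) * (2 * p + 1) :=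
      mul_nonneg (by linarith) (by linarith)
    calc 4 * (4 * (2 * p - 1) * (2 * p + 1) * inverseConst p)
        = (4 * (2 * p - 1) * (2 * p + 1)) * (4 * inverseConst p) := by ring
      _ ≤ (4 * (2 * p - 1) * (2 * p + 1)) * (2 * Cp3 p ^ 2) := by gcongr
      _ ≤ (p * (p + 1) * (p + 2) * (p + 3) / 2) * (2 * Cp3 p ^ 2) := by gcongr
      _ = _ := by ring

/-- The Legendre bound applied to `q'` with `n = p - 1`; the `n`-th derivative of `q'` is `q⁽ᵖ⁾ = p!
* q.coeff p`. -/
lemma sq_factorial_mul_coeff_le_derivative {p : ℕ} (hp : 1 ≤ p) {q : Polynomial ℝ}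
    (hq : q.natDegree ≤ p) {a b : ℝ} (hab : a ≤ b) :
    (b - a) ^ (2 * p - 1) * ((p ! : ℝ) * q.coeff p) ^ 2 ≤
      inverseConst p * ∫ x in a..b, (q.derivative.eval x) ^ 2 := by
  obtain ⟨n, rfl⟩ : ∃ n, p = n + 1 := ⟨p - 1, by omega⟩
  have h := sq_factorial_mul_coeff_le n (v := q.derivative)
    ((Polynomial.natDegree_derivative_le q).trans (by omega)) hab
  rw [Polynomial.coeff_derivative] at h
  have e : ((n + 1)! : ℝ) * q.coeff (n + 1) = n ! * (q.coeff (n + 1) * (n + 1)) := by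
    rw [Nat.factorial_succ]; push_cast; ring
  rw [e, show 2 * (n + 1) - 1 = 2 * n + 1 by omega, mul_comm]
  exact h

/-! ### Fubini in one coordinate direction -/

section FacePoint

variable {d : ℕ}

lemma facePoint_self (j : Fin d) (c : ℝ) (y : {k : Fin d // k ≠ j} → ℝ) :
    facePoint j c y j = c := by simp [facePoint]

lemma facePoint_of_ne (j : Fin d) (c : ℝ) (y : {k : Fin d // k ≠ j} → ℝ)
    (k : {k : Fin d // k ≠ j}) : facePoint j c y k = y k := by simp [facePoint, k.2]

lemma update_facePoint (j : Fin d) (c t : ℝ) (y : {k : Fin d // k ≠ j} → ℝ) :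
    Function.update (facePoint j c y) j t = facePoint j t y := by
  ext k
  by_cases h : k = j
  · subst h; simp [facePoint]
  · simp [facePoint, h]

lemma update_eq_facePoint (j : Fin d) (t : ℝ) (x : Fin d → ℝ) :
    Function.update x j t = facePoint j t (fun k => x k) := by
  ext k
  by_cases h : k = j
  · subst h; simp [facePoint]
  · simp [facePoint, h]

/-- Split the coordinates into those different from `j` and the singleton `{j}`, whose function
space is identified with `ℝ`. -/
lemma measurePreserving_facePoint (j : Fin d) :
    ∃ e : (({k : Fin d // k ≠ j} → ℝ) × ℝ) ≃ᵐ (Fin d → ℝ),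
      MeasurePreserving e volume volume ∧ ∀ z, e z = facePoint j z.2 z.1 := by
  let u : Unique {k : Fin d // ¬ k ≠ j} :=
    { default := ⟨j, by simp⟩, uniq := fun k => Subtype.ext (not_not.1 k.2) }
  let e₁ := MeasurableEquiv.piEquivPiSubtypeProd (fun _ : Fin d => ℝ) (· ≠ j)
  let e₂ := MeasurableEquiv.prodCongr (MeasurableEquiv.refl ({k : Fin d // k ≠ j} → ℝ))
    (MeasurableEquiv.funUnique {k : Fin d // ¬ k ≠ j} ℝ)
  have h₁ : MeasurePreserving e₁ volume volume :=
    volume_preserving_piEquivPiSubtypeProd (fun _ : Fin d => ℝ) (· ≠ j)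
  have h₃ : MeasurePreserving (MeasurableEquiv.funUnique {k : Fin d // ¬ k ≠ j} ℝ) volume volume := by
    convert volume_preserving_funUnique {k : Fin d // ¬ k ≠ j} ℝ
  have h₂ : MeasurePreserving e₂ volume volume := (MeasurePreserving.id volume).prod h₃
  refine ⟨(e₁.trans e₂).symm, (h₂.comp h₁).symm (e₁.trans e₂), fun z => ?_⟩
  rw [MeasurableEquiv.symm_apply_eq]
  refine Prod.ext ?_ ?_
  · funext k
    exact (facePoint_of_ne j z.2 z.1 k).symm
  · exact (facePoint_self j z.2 z.1).symm

lemma setIntegral_Icc_eq_facePoint (j : Fin d) {f : (Fin d → ℝ) → ℝ} (hf : Continuous f)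
    (a b : Fin d → ℝ) :
    ∫ x in Set.Icc a b, f x =
      ∫ y in {y : {k : Fin d // k ≠ j} → ℝ | ∀ k, y k ∈ Set.Icc (a k.1) (b k.1)},
        ∫ t in Set.Icc (a j) (b j), f (facePoint j t y) := by
  obtain ⟨e, he, hez⟩ := measurePreserving_facePoint j
  have hpre : e ⁻¹' Set.Icc a b =
      {y : {k : Fin d // k ≠ j} → ℝ | ∀ k, y k ∈ Set.Icc (a k.1) (b k.1)} ×ˢ Set.Icc (a j) (b j) := by
    ext z
    simp only [Set.mem_preimage, hez, Set.mem_prod, Set.mem_ofPred_eq, ← Set.pi_univ_Icc,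
      Set.mem_pi, Set.mem_univ, true_implies]
    constructor
    · intro h
      refine ⟨fun k => ?_, ?_⟩
      · simpa only [facePoint_of_ne] using h k
      · simpa only [facePoint_self] using h j
    · rintro ⟨h1, h2⟩ k
      by_cases hk : k = j
      · subst hk; rwa [facePoint_self]
      · simpa only [← facePoint_of_ne j z.2 z.1] using h1 ⟨k, hk⟩
  rw [← he.setIntegral_preimage_emb e.measurableEmbedding f, hpre]
  simp only [hez]
  refine setIntegral_prod (fun z : ({k : Fin d // k ≠ j} → ℝ) × ℝ => f (facePoint j z.2 z.1)) ?_
  have h := (hf.integrableOn_Icc (a := a) (b := b) (μ := volume))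
  rw [← he.integrableOn_comp_preimage e.measurableEmbedding, hpre] at h
  refine h.congr_fun (fun z _ => by simp [hez]) ?_
  rw [← hpre]
  exact e.measurable measurableSet_Icc

end FacePoint

/-! ### Geometry of the mesh -/

namespace TensorMesh

variable {d : ℕ} (T : TensorMesh d)

lemma left_lt_right (j : Fin d) (i : Fin (T.N j)) : T.left j i < T.right j i :=
  T.strictMono j Fin.castSucc_lt_succ

lemma N_pos (j : Fin d) : 0 < T.N j := by
  rcases Nat.eq_zero_or_pos (T.N j) with h | h
  · have h0 := T.knot_first j
    have h1 := T.knot_last j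
    rw [show Fin.last (T.N j) = 0 from Fin.ext (by simpa using h), h0] at h1
    norm_num at h1
  · exact h

lemma meshSize_le (j : Fin d) (i : Fin (T.N j)) : T.meshSize ≤ T.right j i - T.left j i :=
  ciInf_le (Set.finite_range _).bddBelow (⟨j, i⟩ : (j : Fin d) × Fin (T.N j))

lemma meshSize_nonneg : 0 ≤ T.meshSize :=
  Real.iInf_nonneg fun c => sub_nonneg.2 (T.left_lt_right c.1 c.2).le

/-- If `t` avoided every cell, induction along the knots would put each knot at or below `t`; but
then `t ≤ 1` lies in the last cell. -/
lemma exists_mem_cell (j : Fin d) {t : ℝ} (ht : t ∈ Set.Icc (0 : ℝ) 1) : ∃ i, t ∈ T.cell j i := by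
  by_contra! hcon
  have hle : ∀ i, T.knot j i ≤ t := by
    intro i
    induction i using Fin.induction with
    | zero => rw [T.knot_first]; exact ht.1
    | succ i ih =>
      by_contra! hlt
      exact hcon i ⟨ih, hlt.le⟩
  have hN := T.N_pos j
  let i : Fin (T.N j) := ⟨T.N j - 1, by omega⟩
  have hi : i.succ = Fin.last (T.N j) := Fin.ext (by simp [i]; omega)
  refine hcon i ⟨hle _, ?_⟩
  rw [right, hi, T.knot_last]
  exact ht.2

lemma cell_subset (j : Fin d) (i : Fin (T.N j)) : T.cell j i ⊆ Set.Icc 0 1 := by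
  rw [← T.knot_first j, ← T.knot_last j]
  exact Set.Icc_subset_Icc ((T.strictMono j).monotone (Fin.zero_le _))
    ((T.strictMono j).monotone (Fin.le_last _))

/-- The interior of an element. -/
def openBox (E : T.Elem) : Set (Fin d → ℝ) :=
  Set.univ.pi fun k => Set.Ioo (T.left k (E k)) (T.right k (E k))

/-- The closed face of an element orthogonal to direction `j`, without its `j`-th coordinate. -/
def faceBox (E : T.Elem) (j : Fin d) : Set ({k : Fin d // k ≠ j} → ℝ) :=
  {y | ∀ k, y k ∈ T.cell k.1 (E k.1)}

lemma measurableSet_openBox (E : T.Elem) : MeasurableSet (T.openBox E) :=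
  MeasurableSet.univ_pi fun _ => measurableSet_Ioo

/-- Closed boxes are compact and cover the cube; open boxes are disjoint, and inside them
`partialDeriv` sees a single polynomial. This allows passing between the two under the integral. -/
lemma openBox_ae_eq (E : T.Elem) :
    T.openBox E =ᵐ[volume] Set.Icc (fun k => T.left k (E k)) (fun k => T.right k (E k)) :=
  Measure.univ_pi_Ioo_ae_eq_Icc

lemma faceBox_eq_pi (E : T.Elem) (j : Fin d) :
    T.faceBox E j = Set.univ.pi fun k : {k : Fin d // k ≠ j} => T.cell k.1 (E k.1) := by
  ext y; simp [faceBox]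

lemma isCompact_faceBox (E : T.Elem) (j : Fin d) : IsCompact (T.faceBox E j) := by
  rw [faceBox_eq_pi]
  exact isCompact_univ_pi fun _ => isCompact_Icc

lemma measurableSet_faceBox (E : T.Elem) (j : Fin d) : MeasurableSet (T.faceBox E j) :=
  (T.isCompact_faceBox E j).isClosed.measurableSet

lemma openBox_subset (E : T.Elem) : T.openBox E ⊆ Set.Icc 0 1 := by
  intro x hx
  rw [← Set.pi_univ_Icc]
  exact fun k hk => T.cell_subset k (E k) (Set.Ioo_subset_Icc_self (hx k hk))

lemma Icc_subset_iUnion :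
    Set.Icc (0 : Fin d → ℝ) 1 ⊆
      ⋃ E : T.Elem, Set.Icc (fun k => T.left k (E k)) (fun k => T.right k (E k)) := by
  intro x hx
  choose E hE using fun j => T.exists_mem_cell j (t := x j) ⟨hx.1 j, hx.2 j⟩
  exact Set.mem_iUnion.2 ⟨E, fun k => (hE k).1, fun k => (hE k).2⟩

lemma pairwise_disjoint_openBox : Pairwise (Function.onFun Disjoint T.openBox) := by
  intro E E' hE
  obtain ⟨j, hj⟩ := Function.ne_iff.1 hE
  rw [Function.onFun, Set.disjoint_left]
  intro x hx hx'
  have h1 := hx j trivial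
  have h2 := hx' j trivial
  rcases lt_or_gt_of_ne hj with h | h
  · have := (T.strictMono j).monotone (Fin.succ_le_castSucc_iff.2 h)
    exact absurd (h1.2.trans_le this) (not_lt.2 h2.1.le)
  · have := (T.strictMono j).monotone (Fin.succ_le_castSucc_iff.2 h)
    exact absurd (h2.2.trans_le this) (not_lt.2 h1.1.le)

/-- An inequality suffices for coercivity, so disjointness and inclusion in the cube are enough
here. -/
lemma sum_setIntegral_openBox_le {f : (Fin d → ℝ) → ℝ} (hf : 0 ≤ f)
    (hi : IntegrableOn f (Set.Icc 0 1)) :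
    ∑ E, ∫ x in T.openBox E, f x ≤ ∫ x in Set.Icc (0 : Fin d → ℝ) 1, f x := by
  rw [← integral_iUnion_fintype T.measurableSet_openBox T.pairwise_disjoint_openBox
    fun E => hi.mono_set (T.openBox_subset E)]
  exact setIntegral_mono_set hi (Filter.Eventually.of_forall hf)
    (Set.iUnion_subset T.openBox_subset).eventuallyLE

/-! ### Polynomial slices of a spline -/

/-- On the element `E`, the restrictions of `w` to the lines in direction `j` are the polynomials
`Q y` of degree at most `p`, whose coefficients are continuous functions of the position `y`. -/
structure IsSlice (p : ℕ) (w : (Fin d → ℝ) → ℝ) (E : T.Elem) (j : Fin d)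
    (Q : ({k : Fin d // k ≠ j} → ℝ) → Polynomial ℝ) : Prop where
  natDegree_le : ∀ y, (Q y).natDegree ≤ p
  continuous_coeff : ∀ i, Continuous fun y => (Q y).coeff i
  eval_eq : ∀ y ∈ T.faceBox E j, ∀ t ∈ T.cell j (E j), w (facePoint j t y) = (Q y).eval t

variable {T}

/-- For a product of one-dimensional splines the slice is the `j`-th piece times the values of the
other pieces. Using the polynomials, not the splines, for those values makes the coefficients
continuous in all `y`. The degree bound and continuity survive linear combinations. -/
lemma exists_isSlice {p : ℕ} {w : (Fin d → ℝ) → ℝ} (hw : w ∈ T.space p) (E : T.Elem) (j : Fin d) :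
    ∃ Q, T.IsSlice p w E j Q := by
  induction hw using Submodule.span_induction with
  | mem w hw =>
    obtain ⟨u, hu, rfl⟩ := hw
    choose q hq hqu using fun k => (hu k).2.1 (E k)
    refine ⟨fun y => Polynomial.C (∏ k : {k : Fin d // k ≠ j}, (q k).eval (y k)) * q j,
      fun y => (Polynomial.natDegree_C_mul_le _ _).trans (hq j), fun i => ?_, fun y hy t ht => ?_⟩
    · simp only [Polynomial.coeff_C_mul]
      fun_prop
    · rw [Polynomial.eval_mul, Polynomial.eval_C, ← Fintype.prod_subtype_mul_prod_subtype (· ≠ j)]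
      congr 1
      · refine Finset.prod_congr rfl fun k _ => ?_
        rw [facePoint_of_ne]
        exact hqu k _ (hy k)
      · let uq : Unique {k : Fin d // ¬ k ≠ j} :=
          { default := ⟨j, by simp⟩, uniq := fun k => Subtype.ext (not_not.1 k.2) }
        rw [Fintype.prod_unique]
        change u j (facePoint j t y j) = _
        rw [facePoint_self]
        exact hqu j t ht
  | zero => exact ⟨fun _ => 0, by simp, by simp [continuous_const], by simp⟩
  | add v w _ _ hv hw =>
    obtain ⟨Q, hQ⟩ := hv
    obtain ⟨R, hR⟩ := hw
    refine ⟨fun y => Q y + R y,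
      fun y => Polynomial.natDegree_add_le_of_degree_le (hQ.natDegree_le y) (hR.natDegree_le y),
      fun i => ?_, fun y hy t ht => ?_⟩
    · simp only [Polynomial.coeff_add]
      exact (hQ.continuous_coeff i).add (hR.continuous_coeff i)
    · simp [hQ.eval_eq y hy t ht, hR.eval_eq y hy t ht]
  | smul c w _ hw =>
    obtain ⟨Q, hQ⟩ := hw
    refine ⟨fun y => c • Q y, fun y => (Polynomial.natDegree_smul_le _ _).trans (hQ.natDegree_le y),
      fun i => ?_, fun y hy t ht => ?_⟩
    · simp only [Polynomial.coeff_smul]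
      exact (hQ.continuous_coeff i).const_smul c
    · simp [hQ.eval_eq y hy t ht]

namespace IsSlice

variable {p : ℕ} {w : (Fin d → ℝ) → ℝ} {E : T.Elem} {j : Fin d}
  {Q : ({k : Fin d // k ≠ j} → ℝ) → Polynomial ℝ}

/-- The `p`-th derivative of a polynomial of degree at most `p` is constant, so the value does not
depend on `c`: the lower and the upper face of `E` see the same function of `y`. -/
lemma elemDeriv_facePoint (hQ : T.IsSlice p w E j Q) {y : {k : Fin d // k ≠ j} → ℝ}
    (hy : y ∈ T.faceBox E j) {c : ℝ} (hc : c ∈ T.cell j (E j)) :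
    T.elemDeriv p w E j (facePoint j c y) = (p ! : ℝ) * (Q y).coeff p := by
  have hiter : ∀ (n : ℕ) (q : Polynomial ℝ),
      iteratedDeriv n (fun t => q.eval t) = fun t => (Polynomial.derivative^[n] q).eval t := by
    intro n
    induction n with
    | zero => intro q; simp
    | succ n ih =>
      intro q
      rw [iteratedDeriv_succ', Function.iterate_succ_apply, ← ih]
      congr 1
      ext t
      exact q.deriv
  have hsm : ContDiff ℝ p fun t => (Q y).eval t := by
    simpa only [Polynomial.coe_aeval_eq_eval] using Polynomial.contDiff_aeval (𝕜 := ℝ) (Q y) p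
  rw [elemDeriv, facePoint_self]
  simp only [update_facePoint]
  rw [iteratedDerivWithin_congr (g := fun t => (Q y).eval t) (fun t ht => hQ.eval_eq y hy t ht) hc,
    iteratedDerivWithin_eq_iteratedDeriv (s := T.cell j (E j))
      (uniqueDiffOn_Icc (T.left_lt_right j (E j)))
      hsm.contDiffAt hc, hiter, iterate_derivative_eq_C (hQ.natDegree_le y)]
  exact Polynomial.eval_C

lemma partialDeriv_eq (hQ : T.IsSlice p w E j Q) {x : Fin d → ℝ} (hx : x ∈ T.openBox E) :
    partialDeriv w j x = (Q fun k => x k).derivative.eval (x j) := by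
  rw [partialDeriv, ← Polynomial.deriv]
  refine Filter.EventuallyEq.deriv_eq ?_
  filter_upwards [Ioo_mem_nhds (hx j trivial).1 (hx j trivial).2] with t ht
  rw [update_eq_facePoint]
  exact hQ.eval_eq _ (fun k => Set.Ioo_subset_Icc_self (hx k trivial)) t
    (Set.Ioo_subset_Icc_self ht)

lemma continuous_eval_derivative (hQ : T.IsSlice p w E j Q) :
    Continuous fun x : Fin d → ℝ => (Q fun k => x k).derivative.eval (x j) := by
  have h : ∀ x : Fin d → ℝ, (Q fun k => x k).derivative.eval (x j) =
      ∑ i ∈ Finset.range (p + 1), ((Q fun k => x k).coeff (i + 1) * (i + 1)) * x j ^ i := by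
    intro x
    -- A summation range independent of `x` replaces the degree, which may vary with `x`.
    rw [Polynomial.eval_eq_sum_range' (n := p + 1)]
    · simp only [Polynomial.coeff_derivative]
    · have := hQ.natDegree_le fun k => x k
      have := Polynomial.natDegree_derivative_le (Q fun k => x k)
      omega
  simp only [h]
  refine continuous_finsetSum _ fun i _ => ?_
  have := (hQ.continuous_coeff (i + 1)).comp
    (continuous_pi fun k : {k : Fin d // k ≠ j} => continuous_apply (A := fun _ : Fin d => ℝ) k.1)
  exact (this.mul continuous_const).mul ((continuous_apply j).pow i)

lemma integrableOn_partialDeriv_sq (hQ : T.IsSlice p w E j Q) :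
    IntegrableOn (fun x => partialDeriv w j x ^ 2)
      (Set.Icc (fun k => T.left k (E k)) (fun k => T.right k (E k))) := by
  refine IntegrableOn.congr_set_ae (t := T.openBox E) ?_ (T.openBox_ae_eq E).symm
  refine IntegrableOn.congr_fun (f := fun x => (Q fun k => x k).derivative.eval (x j) ^ 2) ?_
    (fun x hx => by simp only [hQ.partialDeriv_eq hx]) (T.measurableSet_openBox E)
  exact ((hQ.continuous_eval_derivative.pow 2).integrableOn_Icc).congr_set_ae (T.openBox_ae_eq E)

lemma continuous_leadingDeriv (hQ : T.IsSlice p w E j Q) :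
    Continuous fun y => (p ! : ℝ) * (Q y).coeff p :=
  continuous_const.mul (hQ.continuous_coeff p)

/-- The one-dimensional inverse inequality on each line, integrated over the face by Fubini, with
`h` at most the edge length. -/
lemma meshSize_pow_mul_integral_le (hQ : T.IsSlice p w E j Q) (hp : 1 ≤ p) :
    T.meshSize ^ (2 * p - 1) * ∫ y in T.faceBox E j, ((p ! : ℝ) * (Q y).coeff p) ^ 2 ≤
      inverseConst p * ∫ x in T.openBox E, partialDeriv w j x ^ 2 := by
  have hG : Continuous fun x : Fin d → ℝ => (Q fun k => x k).derivative.eval (x j) ^ 2 :=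
    hQ.continuous_eval_derivative.pow 2
  have h1 : ∫ x in T.openBox E, partialDeriv w j x ^ 2 =
      ∫ y in T.faceBox E j, ∫ t in T.left j (E j)..T.right j (E j),
        ((Q y).derivative.eval t) ^ 2 := by
    rw [setIntegral_congr_fun (g := fun x => (Q fun k => x k).derivative.eval (x j) ^ 2)
      (T.measurableSet_openBox E) (fun x hx => by simp only [hQ.partialDeriv_eq hx]),
      setIntegral_congr_set (T.openBox_ae_eq E), setIntegral_Icc_eq_facePoint j hG]
    refine setIntegral_congr_fun (T.measurableSet_faceBox E j) fun y _ => ?_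
    simp only [facePoint_self, facePoint_of_ne]
    rw [intervalIntegral.integral_of_le (T.left_lt_right j (E j)).le, integral_Icc_eq_integral_Ioc]
  have h2 : Continuous fun y : {k : Fin d // k ≠ j} → ℝ =>
      ∫ t in T.left j (E j)..T.right j (E j), ((Q y).derivative.eval t) ^ 2 := by
    refine intervalIntegral.continuous_parametric_intervalIntegral_of_continuous' ?_ _ _
    have hfp : Continuous fun z : ({k : Fin d // k ≠ j} → ℝ) × ℝ => facePoint j z.2 z.1 := by
      refine continuous_pi fun k => ?_
      by_cases hk : k = j
      · simp only [facePoint, hk, dif_pos]; fun_prop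
      · simp only [facePoint, hk, dif_neg, not_false_eq_true]; fun_prop
    have h := hG.comp hfp
    simpa only [Function.comp_def, facePoint_self, facePoint_of_ne, Function.uncurry_def] using h
  rw [h1, ← integral_const_mul, ← integral_const_mul]
  refine setIntegral_mono_on ?_ ?_ (T.measurableSet_faceBox E j) fun y _ => ?_
  · exact (continuous_const.mul (hQ.continuous_leadingDeriv.pow 2)).continuousOn.integrableOn_compact
      (T.isCompact_faceBox E j)
  · exact (continuous_const.mul h2).continuousOn.integrableOn_compact (T.isCompact_faceBox E j)
  · refine le_trans ?_ (sq_factorial_mul_coeff_le_derivative hp (hQ.natDegree_le y)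
      (T.left_lt_right j (E j)).le)
    gcongr
    · exact T.meshSize_nonneg
    · exact T.meshSize_le j (E j)

end IsSlice

end TensorMesh

/-! ### Counting the faces of each element -/

/-- Used with `s` the interior faces, `g` picking the element on one side, and `t` the boundary
faces on the matching side of the cube. -/
lemma sum_comp_add_sum_le {α β : Type*} [Fintype β] [DecidableEq β] {s : Finset α} {t : Finset β}
    {g : α → β} (hg : Set.InjOn g s) (hd : ∀ a ∈ s, g a ∉ t) {f : β → ℝ} (hf : 0 ≤ f) :
    ∑ a ∈ s, f (g a) + ∑ b ∈ t, f b ≤ ∑ b, f b := by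
  rw [← Finset.sum_image (f := f) hg, ← Finset.sum_union]
  · exact Finset.sum_le_sum_of_subset_of_nonneg (Finset.subset_univ _) fun b _ _ => hf b
  · rw [Finset.disjoint_left]
    intro b hb
    obtain ⟨a, ha, rfl⟩ := Finset.mem_image.1 hb
    exact hd a ha

namespace TensorMesh

variable {d : ℕ} {T : TensorMesh d}

lemma mem_interiorFaces {F : Fin d × T.Elem × T.Elem} : F ∈ T.interiorFaces ↔
    (F.2.2 F.1 : ℕ) = (F.2.1 F.1 : ℕ) + 1 ∧ ∀ k, k ≠ F.1 → F.2.2 k = F.2.1 k := by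
  simp [interiorFaces]

lemma mem_lowerBoundaryFaces {F : Fin d × T.Elem} :
    F ∈ T.lowerBoundaryFaces ↔ (F.2 F.1 : ℕ) = 0 := by
  simp [lowerBoundaryFaces]

lemma mem_upperBoundaryFaces {F : Fin d × T.Elem} :
    F ∈ T.upperBoundaryFaces ↔ (F.2 F.1 : ℕ) + 1 = T.N F.1 := by
  simp [upperBoundaryFaces]

/-- Every element has at most one upper face in each direction. -/
lemma sum_lowerElement_add_sum_upperBoundary_le {f : Fin d × T.Elem → ℝ} (hf : 0 ≤ f) :
    ∑ F ∈ T.interiorFaces, f (F.1, F.2.1) + ∑ F ∈ T.upperBoundaryFaces, f F ≤ ∑ F, f F := by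
  classical
  refine sum_comp_add_sum_le (g := fun F : Fin d × T.Elem × T.Elem => (F.1, F.2.1)) ?_ ?_ hf
  · rintro ⟨j, E, E₁⟩ h ⟨j', E', E₂⟩ h' heq
    obtain ⟨rfl, rfl⟩ := Prod.mk.inj heq
    have h := mem_interiorFaces.1 h
    have h' := mem_interiorFaces.1 h'
    have : E₁ = E₂ := by
      funext k
      by_cases hk : k = j
      · subst hk; exact Fin.ext (h.1.trans h'.1.symm)
      · exact (h.2 k hk).trans (h'.2 k hk).symm
    rw [this]
  · intro F hF h
    have h1 := (mem_interiorFaces.1 hF).1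
    have h2 := mem_upperBoundaryFaces.1 h
    -- The lower element of an interior face has a neighbour above it, so it cannot be last in its
    -- direction.
    have h3 := (F.2.2 F.1).2
    simp only at h2
    omega

/-- Every element has at most one lower face in each direction. -/
lemma sum_upperElement_add_sum_lowerBoundary_le {f : Fin d × T.Elem → ℝ} (hf : 0 ≤ f) :
    ∑ F ∈ T.interiorFaces, f (F.1, F.2.2) + ∑ F ∈ T.lowerBoundaryFaces, f F ≤ ∑ F, f F := by
  classical
  refine sum_comp_add_sum_le (g := fun F : Fin d × T.Elem × T.Elem => (F.1, F.2.2)) ?_ ?_ hf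
  · rintro ⟨j, E₁, E⟩ h ⟨j', E₂, E'⟩ h' heq
    obtain ⟨rfl, rfl⟩ := Prod.mk.inj heq
    have h := mem_interiorFaces.1 h
    have h' := mem_interiorFaces.1 h'
    have : E₁ = E₂ := by
      funext k
      by_cases hk : k = j
      · subst hk; exact Fin.ext (Nat.succ_injective (h.1.symm.trans h'.1))
      · exact (h.2 k hk).symm.trans (h'.2 k hk)
    rw [this]
  · intro F hF h
    have h1 := (mem_interiorFaces.1 hF).1
    have h2 := mem_lowerBoundaryFaces.1 h
    simp only at h2
    omega

lemma left_mem_cell (j : Fin d) (i : Fin (T.N j)) : T.left j i ∈ T.cell j i :=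
  ⟨le_rfl, (T.left_lt_right j i).le⟩

lemma right_mem_cell (j : Fin d) (i : Fin (T.N j)) : T.right j i ∈ T.cell j i :=
  ⟨(T.left_lt_right j i).le, le_rfl⟩

/-! ### Bounding the softness form -/

/-- The squared `L²` norm of the `p`-th derivative `p! (Q y).coeff p` over a face. -/
def leadingNormSq (p : ℕ) (E : T.Elem) (j : Fin d)
    (Q : ({k : Fin d // k ≠ j} → ℝ) → Polynomial ℝ) : ℝ :=
  ∫ y in T.faceBox E j, ((p ! : ℝ) * (Q y).coeff p) ^ 2

lemma leadingNormSq_nonneg (p : ℕ) (E : T.Elem) (j : Fin d)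
    (Q : ({k : Fin d // k ≠ j} → ℝ) → Polynomial ℝ) : 0 ≤ leadingNormSq p E j Q :=
  integral_nonneg fun _ => sq_nonneg _

variable {p : ℕ} {w : (Fin d → ℝ) → ℝ}

lemma IsSlice.faceIntegral_sq {E : T.Elem} {j : Fin d}
    {Q : ({k : Fin d // k ≠ j} → ℝ) → Polynomial ℝ} (hQ : T.IsSlice p w E j Q) {c s : ℝ}
    (hc : c ∈ T.cell j (E j)) (hs : s ^ 2 = 1) :
    T.faceIntegral E j c (fun x => (T.elemDeriv p w E j x * s) * (T.elemDeriv p w E j x * s)) =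
      leadingNormSq p E j Q := by
  refine setIntegral_congr_fun (T.measurableSet_faceBox E j) fun y hy => ?_
  simp only [hQ.elemDeriv_facePoint hy hc]
  linear_combination ((p ! : ℝ) * (Q y).coeff p) ^ 2 * hs

/-- Pointwise this is `(a - b)² ≤ 2a² + 2b²`; both elements have the same face box, and the right
end of one is the left end of the other. -/
lemma faceIntegral_jump_le {F : Fin d × T.Elem × T.Elem} (hF : F ∈ T.interiorFaces)
    {Q R : ({k : Fin d // k ≠ F.1} → ℝ) → Polynomial ℝ} (hQ : T.IsSlice p w F.2.1 F.1 Q)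
    (hR : T.IsSlice p w F.2.2 F.1 R) :
    T.faceIntegral F.2.1 F.1 (T.right F.1 (F.2.1 F.1))
        (fun x => T.jump p w F x * T.jump p w F x) ≤
      2 * leadingNormSq p F.2.1 F.1 Q + 2 * leadingNormSq p F.2.2 F.1 R := by
  obtain ⟨j, E₁, E₂⟩ := F
  obtain ⟨h1, h2⟩ := mem_interiorFaces.1 hF
  simp only at h1 h2 hQ hR ⊢
  have hbox : T.faceBox E₂ j = T.faceBox E₁ j := by
    ext y
    exact forall_congr' fun k => by rw [h2 k.1 k.2]
  have hlr : T.right j (E₁ j) = T.left j (E₂ j) := by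
    unfold right left
    congr 1
    exact Fin.ext (by simp [h1])
  have hQi : IntegrableOn (fun y => ((p ! : ℝ) * (Q y).coeff p) ^ 2) (T.faceBox E₁ j) :=
    (hQ.continuous_leadingDeriv.pow 2).continuousOn.integrableOn_compact (T.isCompact_faceBox E₁ j)
  have hRi : IntegrableOn (fun y => ((p ! : ℝ) * (R y).coeff p) ^ 2) (T.faceBox E₁ j) :=
    (hR.continuous_leadingDeriv.pow 2).continuousOn.integrableOn_compact (T.isCompact_faceBox E₁ j)
  have hJ : T.faceIntegral E₁ j (T.right j (E₁ j))
        (fun x => T.jump p w (j, E₁, E₂) x * T.jump p w (j, E₁, E₂) x) =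
      ∫ y in T.faceBox E₁ j, ((p ! : ℝ) * (Q y).coeff p - (p ! : ℝ) * (R y).coeff p) ^ 2 := by
    refine setIntegral_congr_fun (T.measurableSet_faceBox E₁ j) fun y hy => ?_
    simp only [jump]
    rw [hQ.elemDeriv_facePoint hy (right_mem_cell j _), hlr,
      hR.elemDeriv_facePoint (hbox ▸ hy) (left_mem_cell j _)]
    ring
  rw [hJ, leadingNormSq, leadingNormSq, hbox, ← integral_const_mul, ← integral_const_mul,
    ← integral_add (hQi.const_mul 2) (hRi.const_mul 2)]
  refine setIntegral_mono_on ?_ ((hQi.const_mul 2).add (hRi.const_mul 2))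
    (T.measurableSet_faceBox E₁ j) fun y _ => ?_
  · exact ((hQ.continuous_leadingDeriv.sub hR.continuous_leadingDeriv).pow
      2).continuousOn.integrableOn_compact (T.isCompact_faceBox E₁ j)
  · nlinarith [sq_nonneg ((p ! : ℝ) * (Q y).coeff p + (p ! : ℝ) * (R y).coeff p)]

/-- Interior faces cost a factor 2 through the jump, and boundary faces carry weight 2 or 0. A pair
(direction, element) occurs at most once through its upper and once through its lower face: 2 + 2 =
4. -/
lemma softnessForm_le_sum {Q : ∀ F : Fin d × T.Elem, ({k : Fin d // k ≠ F.1} → ℝ) → Polynomial ℝ}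
    (hQ : ∀ F, T.IsSlice p w F.2 F.1 (Q F)) :
    T.softnessForm p w w ≤
      4 * ∑ F, T.meshSize ^ (2 * p - 1) * leadingNormSq p F.2 F.1 (Q F) := by
  have hH : 0 ≤ T.meshSize ^ (2 * p - 1) := pow_nonneg T.meshSize_nonneg _
  set f : Fin d × T.Elem → ℝ :=
    fun F => T.meshSize ^ (2 * p - 1) * leadingNormSq p F.2 F.1 (Q F) with hf
  have hf0 : 0 ≤ f := fun F => mul_nonneg hH (leadingNormSq_nonneg _ _ _ _)
  have hint : T.interiorPenalty p w w ≤
      2 * ∑ F ∈ T.interiorFaces, f (F.1, F.2.1) + 2 * ∑ F ∈ T.interiorFaces, f (F.1, F.2.2) := by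
    rw [interiorPenalty, Finset.mul_sum, Finset.mul_sum, ← Finset.sum_add_distrib]
    refine Finset.sum_le_sum fun F hF => ?_
    refine (mul_le_mul_of_nonneg_left
      (faceIntegral_jump_le hF (hQ (F.1, F.2.1)) (hQ (F.1, F.2.2))) hH).trans_eq ?_
    simp only [hf]
    ring
  have hbdry : T.boundaryPenalty p w w =
      ∑ F ∈ T.lowerBoundaryFaces, f F + ∑ F ∈ T.upperBoundaryFaces, f F := by
    rw [boundaryPenalty]
    congr 1
    · refine Finset.sum_congr rfl fun F _ => ?_
      rw [(hQ F).faceIntegral_sq (left_mem_cell _ _) (by norm_num)]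
    · refine Finset.sum_congr rfl fun F _ => ?_
      rw [(hQ F).faceIntegral_sq (right_mem_cell _ _) (by norm_num)]
  have h1 := sum_lowerElement_add_sum_upperBoundary_le hf0
  have h2 := sum_upperElement_add_sum_lowerBoundary_le hf0
  have h3 : 0 ≤ ∑ F ∈ T.lowerBoundaryFaces, f F := Finset.sum_nonneg fun F _ => hf0 F
  have h4 : 0 ≤ ∑ F ∈ T.upperBoundaryFaces, f F := Finset.sum_nonneg fun F _ => hf0 F
  rw [softnessForm]
  split_ifs
  -- For odd `p` there is no boundary term, and the nonnegative boundary sums in the face counts are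
  -- dropped.
  · linarith
  · rw [hbdry]
    linarith

lemma integrableOn_partialDeriv_sq (hw : w ∈ T.space p) (j : Fin d) :
    IntegrableOn (fun x => partialDeriv w j x ^ 2) (Set.Icc 0 1) := by
  refine IntegrableOn.mono_set ?_ T.Icc_subset_iUnion
  rw [integrableOn_finite_iUnion]
  intro E
  obtain ⟨Q, hQ⟩ := exists_isSlice hw E j
  exact hQ.integrableOn_partialDeriv_sq

lemma softnessForm_le (hp : 1 ≤ p) (hw : w ∈ T.space p) :
    T.softnessForm p w w ≤ 2 * Cp3 p ^ 2 * stiffnessForm w w := by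
  choose Q hQ using fun F : Fin d × T.Elem => exists_isSlice hw F.2 F.1
  have hstiff : stiffnessForm w w =
      ∑ j, ∫ x in Set.Icc (0 : Fin d → ℝ) 1, partialDeriv w j x ^ 2 := by
    rw [stiffnessForm, ← integral_finsetSum _ fun j _ => integrableOn_partialDeriv_sq hw j]
    simp only [sq]
  have hstiff0 : 0 ≤ stiffnessForm w w := by
    rw [hstiff]
    exact Finset.sum_nonneg fun j _ => integral_nonneg fun _ => sq_nonneg _
  calc T.softnessForm p w w
      ≤ 4 * ∑ F, T.meshSize ^ (2 * p - 1) * leadingNormSq p F.2 F.1 (Q F) :=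
        softnessForm_le_sum hQ
    _ ≤ 4 * ∑ F : Fin d × T.Elem,
          inverseConst p * ∫ x in T.openBox F.2, partialDeriv w F.1 x ^ 2 :=
        mul_le_mul_of_nonneg_left
          (Finset.sum_le_sum fun F _ => (hQ F).meshSize_pow_mul_integral_le hp) (by norm_num)
    _ = 4 * inverseConst p *
          ∑ j, ∑ E : T.Elem, ∫ x in T.openBox E, partialDeriv w j x ^ 2 := by
        rw [← Finset.mul_sum, Fintype.sum_prod_type, mul_assoc]
    _ ≤ 4 * inverseConst p * stiffnessForm w w := by
        rw [hstiff]
        have := inverseConst_nonneg p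
        gcongr with j
        exact T.sum_setIntegral_openBox_le (fun _ => sq_nonneg _)
          (integrableOn_partialDeriv_sq hw j)
    _ ≤ 2 * Cp3 p ^ 2 * stiffnessForm w w :=
        mul_le_mul_of_nonneg_right (inverseConst_le hp) hstiff0

end TensorMesh

/-! ### Coercivity -/

lemma h1Seminorm_sq {d : ℕ} (w : (Fin d → ℝ) → ℝ) : h1Seminorm w ^ 2 = stiffnessForm w w := by
  rw [h1Seminorm, Real.sq_sqrt (integral_nonneg fun x => Finset.sum_nonneg fun j _ => sq_nonneg _),
    stiffnessForm]
  simp only [sq]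

lemma etaMax_pos (p : ℕ) : 0 < etaMax p :=
  one_div_pos.2 (mul_pos two_pos (Cp3_sq_pos p))

end SoftIGA

end

theorem theorem1 (d p : ℕ) (hd : 1 ≤ d) (hp : 1 ≤ p) (T : SoftIGA.TensorMesh d)
    (η : ℝ) (hη : η ∈ Set.Ico 0 (SoftIGA.etaMax p)) :
    0 < 1 - η / SoftIGA.etaMax p ∧
    ∀ w ∈ T.space p,
      T.softForm p η w w ≥ (1 - η / SoftIGA.etaMax p) * SoftIGA.h1Seminorm w ^ 2 := by
  refine ⟨sub_pos.2 ((div_lt_one (SoftIGA.etaMax_pos p)).2 hη.2), fun w hw => ?_⟩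
  -- Multiplying `s ≤ a / η_max` by `η ≥ 0` gives `a - η s ≥ (1 - η / η_max) a`, and `a(w,w)` is the
  -- squared seminorm.
  have h := mul_le_mul_of_nonneg_left (SoftIGA.TensorMesh.softnessForm_le hp hw) hη.1
  have e : η / SoftIGA.etaMax p = η * (2 * SoftIGA.Cp3 p ^ 2) := by
    rw [SoftIGA.etaMax, div_div_eq_mul_div, div_one]
  rw [SoftIGA.h1Seminorm_sq, SoftIGA.TensorMesh.softForm, e]
  linarith
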